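/- Let $X\in\mathbb{R}^{m\times n}$, $0<p,q<2$, $\lambda>0$ and $\mu>0$. For a real matrix $A$ with singular values $\sigma_i(A)$ and columns $A_j$ write $\|A\|_{S_p}^p=\sum_i\sigma_i(A)^p$ and $\|A\|_{2,q}^q=\sum_j\|A_j\|_2^q$. The smoothed low-rank representation (LRR) problem is to minimize, over $Z\in\mathbb{R}^{n\times n}$, $$\mathcal{J}(Z,\mu)=\left\|\begin{bmatrix}Z\\ \mu I\end{bmatrix}\right\|_{S_p}^p+\lambda\left\|\begin{bmatrix}XZ-X\\ \mu\mathbf{1}^T\end{bmatrix}\right\|_{2,q}^q ,$$ where $\mathbf 1\in\mathbb{R}^n$ is the all-ones vector. For $Z\in\mathbb{R}^{n\times n}$ let $M(Z)=(Z^TZ+\mu^2I)^{\frac p2-1}$ and let $N(Z)$ be the diagonal matrix with entries $N(Z)_{ii}=(\|(XZ-X)_i\|_2^2+\mu^2)^{\frac q2-1}$. Let $\{Z_t\}_{t\ge1}$ be generated by iteratively reweighted least squares (IRLS), run without a stopping test: $M_0=N_0=I$ and, for $t=0,1,2,\dots$, $Z_{t+1}$ solves $$pZ_{t+1}M_t+\lambda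 qX^T(XZ_{t+1}-X)N_t=0,$$ and $M_{t+1}=M(Z_{t+1})$, $N_{t+1}=N(Z_{t+1})$. Then every limit point $Z^*$ of $\{Z_t\}$ (the limit of a convergent subsequence) satisfies the first-order condition $$pZ^*M(Z^*)+\lambda qX^T(XZ^*-X)N(Z^*)=0$$ and is a stationary point of the smoothed LRR problem, i.e. $\mathcal{J}(\cdot,\mu)$ is differentiable at $Z^*$ with derivative zero. If moreover $p,q\ge1$, then $\mathcal{J}(\cdot,\mu)$ is convex on $\mathbb{R}^{n\times n}$ and $Z^*$ is a global minimizer of it. -/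

import Mathlib

open Filter Topology

namespace SmoothedLRR

noncomputable section

/-- `‖A‖_{S_p}^p = ∑ i, σ_i(A) ^ p`, the sum of the `p`-th powers of the singular values of `A`
(for a matrix with `n` columns, `σ_i(A)` is the square root of the `i`-th eigenvalue of `Aᵀ A`,
`i < n`). -/
def schattenPow {ι : Type*} [Fintype ι] {n : ℕ} (p : ℝ) (A : Matrix ι (Fin n) ℝ) : ℝ :=
  ∑ i : Fin n, (Matrix.toEuclideanLin A).singularValues i ^ p

/-- The Euclidean norm of the `j`-th column of `A`. -/
def colNorm {ι : Type*} [Fintype ι] {n : ℕ} (A : Matrix ι (Fin n) ℝ) (j : Fin n) : ℝ :=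
  ‖WithLp.toLp 2 (A.col j)‖

/-- `‖A‖_{2,q}^q = ∑ j, ‖A_j‖₂ ^ q`, the sum over the columns of `A`. -/
def l2qPow {ι : Type*} [Fintype ι] {n : ℕ} (q : ℝ) (A : Matrix ι (Fin n) ℝ) : ℝ :=
  ∑ j : Fin n, colNorm A j ^ q

/-- The objective of smoothed LRR:
`J(Z, μ) = ‖[Z; μ I]‖_{S_p}^p + λ ‖[X Z - X; μ 1ᵀ]‖_{2,q}^q`. -/
def objective {m n : ℕ} (X : Matrix (Fin m) (Fin n) ℝ) (p q lam μ : ℝ)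
    (Z : Matrix (Fin n) (Fin n) ℝ) : ℝ :=
  schattenPow p (Matrix.fromRows Z (μ • (1 : Matrix (Fin n) (Fin n) ℝ))) +
    lam * l2qPow q (Matrix.fromRows (X * Z - X) (Matrix.replicateRow Unit fun _ : Fin n => μ))

/-- The real power `A ^ r` of a symmetric positive definite matrix (through its spectral
decomposition). -/
def symPow {n : ℕ} (A : Matrix (Fin n) (Fin n) ℝ) (r : ℝ) : Matrix (Fin n) (Fin n) ℝ :=
  cfc (fun x : ℝ => x ^ r) A

/-- The weight matrix `M = (Zᵀ Z + μ² I) ^ (p / 2 - 1)`. -/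
def weightM {n : ℕ} (p μ : ℝ) (Z : Matrix (Fin n) (Fin n) ℝ) : Matrix (Fin n) (Fin n) ℝ :=
  symPow (Z.transpose * Z + μ ^ 2 • (1 : Matrix (Fin n) (Fin n) ℝ)) (p / 2 - 1)

/-- The diagonal weight matrix `N` with `N_ii = (‖(X Z - X)_i‖₂² + μ²) ^ (q / 2 - 1)`. -/
def weightN {m n : ℕ} (X : Matrix (Fin m) (Fin n) ℝ) (q μ : ℝ)
    (Z : Matrix (Fin n) (Fin n) ℝ) : Matrix (Fin n) (Fin n) ℝ :=
  Matrix.diagonal fun i => (colNorm (X * Z - X) i ^ 2 + μ ^ 2) ^ (q / 2 - 1)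

/-- The left-hand side `p Z M + λ q Xᵀ (X Z - X) N` of the weighted least squares equation. -/
def irlsLHS {m n : ℕ} (X : Matrix (Fin m) (Fin n) ℝ) (p q lam : ℝ)
    (Z M N : Matrix (Fin n) (Fin n) ℝ) : Matrix (Fin n) (Fin n) ℝ :=
  p • (Z * M) + (lam * q) • (X.transpose * (X * Z - X) * N)

/-- `Z`, `M`, `N` are sequences generated by the IRLS algorithm, run without a stopping test.
The algorithm starts from the weights `M₀ = N₀ = I` and its iterates are `Z₁, Z₂, …`;
the entry `Z 0` is not used. -/
structure IsIRLS {m n : ℕ} (X : Matrix (Fin m) (Fin n) ℝ) (p q lam μ : ℝ)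
    (Z M N : ℕ → Matrix (Fin n) (Fin n) ℝ) : Prop where
  initM : M 0 = 1
  initN : N 0 = 1
  stepZ : ∀ t, irlsLHS X p q lam (Z (t + 1)) (M t) (N t) = 0
  stepM : ∀ t, M (t + 1) = weightM p μ (Z (t + 1))
  stepN : ∀ t, N (t + 1) = weightN X q μ (Z (t + 1))

/-- `a` is a limit point of the sequence `u`: some subsequence of `u` converges to `a`. -/
def IsLimitPoint {α : Type*} [TopologicalSpace α] (u : ℕ → α) (a : α) : Prop :=
  ∃ φ : ℕ → ℕ, StrictMono φ ∧ Tendsto (u ∘ φ) atTop (𝓝 a)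

/-- `a` is a stationary point of the problem of minimizing `f`: the function `f` is
(Fréchet) differentiable at `a` and its derivative there is zero. -/
def IsStationaryPoint {n : ℕ} (f : Matrix (Fin n) (Fin n) ℝ → ℝ)
    (a : Matrix (Fin n) (Fin n) ℝ) : Prop :=
  HasFDerivAt f (0 : Matrix (Fin n) (Fin n) ℝ →L[ℝ] ℝ) a

end

end SmoothedLRR

/-! IRLS is a majorization scheme. For `0 < s < 1` the power `x ^ s` lies below its tangents. With
`s = p / 2` on eigenvalues (Klein's inequality `trace_cfc_le`) and `s = q / 2` on squared column
norms, the objective `J` is bounded above by a quadratic `surrogate` with weights frozen at `Z`, up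
to a constant, with equality at `Z` (`objective_le_surrogate`).

The gradient of the surrogate is `irlsLHS`, so a step kills its linear term and `J` drops by at
least a weighted square of the step. Bounded `J` bounds the spectrum of `Zᵀ Z + μ² I`, which keeps
`M` uniformly positive; as `J ≥ 0` decreases, steps tend to `0`. Consecutive iterates then share
limit points, and continuity of the weights gives the first-order condition.

Stationarity needs no derivative of a spectral function: the majorization anchored at `Z*` bounds `J
Z - J Z*` above, and the one anchored at `Z` bounds it below, both by `o(‖Z - Z*‖)`.

For `p, q ≥ 1`, the Schatten term is a maximum of convex functions `∑ |⟨u i, A v i⟩| ^ p` over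
orthonormal families, so `J` is convex and stationary points are global minimizers. -/

namespace SmoothedLRR

/-! ### Trace inequalities and the spectral form of the Schatten term -/

section Spectral

variable {n : ℕ}

open Matrix

theorem cfc_eq_mul {A : Matrix (Fin n) (Fin n) ℝ} (hA : A.IsHermitian) (f : ℝ → ℝ) :
    cfc f A = (hA.eigenvectorUnitary : Matrix (Fin n) (Fin n) ℝ) *
      diagonal (fun i => f (hA.eigenvalues i)) *
        (hA.eigenvectorUnitary : Matrix (Fin n) (Fin n) ℝ)ᵀ := by
  rw [hA.cfc_eq, IsHermitian.cfc, Unitary.conjStarAlgAut_apply]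
  rfl

theorem cfc_transpose (A : Matrix (Fin n) (Fin n) ℝ) (f : ℝ → ℝ) : (cfc f A)ᵀ = cfc f A := by
  have h : IsSelfAdjoint (cfc f A) := cfc_predicate f A
  simpa [star_eq_conjTranspose, conjTranspose_eq_transpose_of_trivial] using h.star_eq

theorem transpose_mul_eigenvectorUnitary {A : Matrix (Fin n) (Fin n) ℝ} (hA : A.IsHermitian) :
    (hA.eigenvectorUnitary : Matrix (Fin n) (Fin n) ℝ)ᵀ * hA.eigenvectorUnitary = 1 :=
  Unitary.coe_star_mul_self hA.eigenvectorUnitary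

/-- The squared inner products of the eigenvectors of two symmetric matrices. -/
noncomputable def overlap {A B : Matrix (Fin n) (Fin n) ℝ} (hA : A.IsHermitian)
    (hB : B.IsHermitian) (i j : Fin n) : ℝ :=
  ((hA.eigenvectorUnitary : Matrix (Fin n) (Fin n) ℝ)ᵀ *
    (hB.eigenvectorUnitary : Matrix (Fin n) (Fin n) ℝ)) i j ^ 2

theorem trace_diagonal_mul_diagonal_mul (d e : Fin n → ℝ) (W : Matrix (Fin n) (Fin n) ℝ) :
    (diagonal d * W * diagonal e * Wᵀ).trace = ∑ i, ∑ j, d i * e j * W i j ^ 2 := by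
  simp only [trace, diag_apply, mul_apply (N := Wᵀ), mul_diagonal, diagonal_mul, transpose_apply]
  exact Finset.sum_congr rfl fun i _ => Finset.sum_congr rfl fun j _ => by ring

theorem trace_cfc_mul_cfc {A B : Matrix (Fin n) (Fin n) ℝ} (hA : A.IsHermitian)
    (hB : B.IsHermitian) (f g : ℝ → ℝ) :
    (cfc f A * cfc g B).trace =
      ∑ i, ∑ j, f (hA.eigenvalues i) * g (hB.eigenvalues j) * overlap hA hB i j := by
  unfold overlap
  rw [← trace_diagonal_mul_diagonal_mul, cfc_eq_mul hA, cfc_eq_mul hB, transpose_mul,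
    transpose_transpose]
  simp only [Matrix.mul_assoc]
  rw [trace_mul_comm]
  simp only [Matrix.mul_assoc]

theorem trace_cfc {A : Matrix (Fin n) (Fin n) ℝ} (hA : A.IsHermitian) (f : ℝ → ℝ) :
    (cfc f A).trace = ∑ i, f (hA.eigenvalues i) := by
  rw [cfc_eq_mul hA, Matrix.mul_assoc, trace_mul_comm, Matrix.mul_assoc,
    transpose_mul_eigenvectorUnitary, Matrix.mul_one, trace_diagonal]

theorem trace_cfc_mul_transpose_mul_self {A : Matrix (Fin n) (Fin n) ℝ} (hA : A.IsHermitian)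
    (f : ℝ → ℝ) (D : Matrix (Fin n) (Fin n) ℝ) :
    (cfc f A * (Dᵀ * D)).trace =
      ∑ i, f (hA.eigenvalues i) *
        ∑ k, (D * (hA.eigenvectorUnitary : Matrix (Fin n) (Fin n) ℝ)) k i ^ 2 := by
  have h : (cfc f A * (Dᵀ * D)).trace =
      (diagonal (fun i => f (hA.eigenvalues i)) *
        ((D * (hA.eigenvectorUnitary : Matrix (Fin n) (Fin n) ℝ))ᵀ *
          (D * (hA.eigenvectorUnitary : Matrix (Fin n) (Fin n) ℝ)))).trace := by
    rw [cfc_eq_mul hA, transpose_mul]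
    simp only [Matrix.mul_assoc]
    rw [trace_mul_comm]
    simp only [Matrix.mul_assoc]
  rw [h]
  simp only [trace, diag_apply, diagonal_mul]
  refine Finset.sum_congr rfl fun i _ => ?_
  rw [mul_apply]
  simp only [transpose_apply, sq]

/-- **Klein's inequality** for a function `f` lying below its "tangents" with slopes `g`. -/
theorem trace_cfc_le {A B : Matrix (Fin n) (Fin n) ℝ} (hA : A.IsHermitian) (hB : B.IsHermitian)
    {f g : ℝ → ℝ} {s : Set ℝ} (hAs : ∀ i, hA.eigenvalues i ∈ s) (hBs : ∀ i, hB.eigenvalues i ∈ s)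
    (hfg : ∀ x ∈ s, ∀ y ∈ s, f x ≤ f y + g y * (x - y)) :
    (cfc f A).trace ≤ (cfc f B).trace + (cfc g B * (A - B)).trace := by
  -- Inserting the identity as `cfc 1` of the other matrix turns every trace into a double sum with
  -- the same nonnegative weights `overlap`, so the scalar inequality applies termwise.
  have e1 : (cfc f A).trace = (cfc f A * cfc (fun _ => (1 : ℝ)) B).trace := by
    rw [cfc_const_one ℝ B hB.isSelfAdjoint, Matrix.mul_one]
  have e2 : (cfc f B).trace = (cfc (fun _ => (1 : ℝ)) A * cfc f B).trace := by
    rw [cfc_const_one ℝ A hA.isSelfAdjoint, Matrix.one_mul]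
  have e3 : (cfc g B * A).trace = (cfc (fun x : ℝ => x) A * cfc g B).trace := by
    rw [cfc_id' ℝ A hA.isSelfAdjoint, trace_mul_comm]
  have h4 : cfc (fun x => g x * x) B = cfc g B * B := by
    have h := cfc_mul (p := IsSelfAdjoint) g (fun x : ℝ => x) B
      (B.finite_real_spectrum.continuousOn _) (B.finite_real_spectrum.continuousOn _)
    rwa [cfc_id' ℝ B hB.isSelfAdjoint] at h
  have e4 : (cfc g B * B).trace = (cfc (fun _ => (1 : ℝ)) A * cfc (fun x => g x * x) B).trace := by
    rw [cfc_const_one ℝ A hA.isSelfAdjoint, Matrix.one_mul, h4]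
  rw [mul_sub, trace_sub, e1, e2, e3, e4]
  simp only [trace_cfc_mul_cfc hA hB]
  simp only [← Finset.sum_add_distrib, ← Finset.sum_sub_distrib]
  refine Finset.sum_le_sum fun i _ => Finset.sum_le_sum fun j _ => ?_
  have h := mul_le_mul_of_nonneg_right (hfg _ (hAs i) _ (hBs j))
    (show 0 ≤ overlap hA hB i j from sq_nonneg _)
  linarith

/-- Bernoulli's inequality for exponents in `(0, 1)`, applied to `x / y` and rescaled by `y ^ s`. -/
theorem rpow_le_tangent {s : ℝ} (hs0 : 0 < s) (hs1 : s < 1) {x y : ℝ} (hx : 0 < x) (hy : 0 < y) :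
    x ^ s ≤ y ^ s + s * y ^ (s - 1) * (x - y) := by
  have h := rpow_one_add_le_one_add_mul_self (s := x / y - 1)
    (by linarith [div_pos hx hy]) hs0.le hs1.le
  have hys : 0 < y ^ s := Real.rpow_pos_of_pos hy s
  rw [show 1 + (x / y - 1) = x / y by ring, Real.div_rpow hx.le hy.le, div_le_iff₀ hys] at h
  refine h.trans_eq ?_
  rw [Real.rpow_sub hy, Real.rpow_one]
  field_simp

/-- The regularized Gram matrix `Zᵀ Z + μ² I`. -/
noncomputable def regGram (μ : ℝ) (Z : Matrix (Fin n) (Fin n) ℝ) : Matrix (Fin n) (Fin n) ℝ :=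
  Zᵀ * Z + μ ^ 2 • (1 : Matrix (Fin n) (Fin n) ℝ)

theorem regGram_posDef {μ : ℝ} (hμ : 0 < μ) (Z : Matrix (Fin n) (Fin n) ℝ) :
    (regGram μ Z).PosDef := by
  refine PosDef.posSemidef_add ?_ (PosDef.one.smul (by positivity))
  simpa [conjTranspose_eq_transpose_of_trivial] using posSemidef_conjTranspose_mul_self Z

/-- Because `μ > 0`, all spectra lie in `(0, ∞)`, where the possibly negative power is continuous;
the functional calculus is then continuous in the matrix. -/
theorem continuous_weightM (p : ℝ) {μ : ℝ} (hμ : 0 < μ) :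
    Continuous (weightM p μ : Matrix (Fin n) (Fin n) ℝ → _) := by
  open scoped Matrix.Norms.L2Operator in
  refine Continuous.cfc_of_mem_nhdsSet (𝕜 := ℝ) (p := IsSelfAdjoint) (s := Set.Ioi 0)
    (fun x : ℝ => x ^ (p / 2 - 1)) (a := regGram μ) ?_ ?_ ?_ ?_
  · refine isOpen_Ioi.mem_nhdsSet.2 (Set.iUnion_subset fun Z => ?_)
    rw [(regGram_posDef hμ Z).isHermitian.spectrum_real_eq_range_eigenvalues]
    rintro _ ⟨i, rfl⟩
    exact (regGram_posDef hμ Z).eigenvalues_pos i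
  · exact (continuous_id.matrix_transpose.matrix_mul continuous_id).add continuous_const
  · exact fun Z => (regGram_posDef hμ Z).isHermitian.isSelfAdjoint
  · exact fun x hx => (Real.continuousAt_rpow_const x _ (Or.inl (ne_of_gt hx))).continuousWithinAt

theorem sum_eigenvalues_eq_sum_roots {E : Type*} [NormedAddCommGroup E] [InnerProductSpace ℝ E]
    [FiniteDimensional ℝ E] {T : E →ₗ[ℝ] E} (hT : T.IsSymmetric) (hn : Module.finrank ℝ E = n)
    (g : ℝ → ℝ) : ∑ i, g (hT.eigenvalues hn i) = (T.charpoly.roots.map g).sum := by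
  rw [hT.roots_charpoly_eq_eigenvalues hn, Multiset.map_map]
  rfl

/-- Singular values and `hB.eigenvalues` come from separate enumerations; both are the roots of one
characteristic polynomial, and the sum ignores their order. -/
theorem schattenPow_eq_sum {ι : Type*} [Fintype ι] (p : ℝ) (A : Matrix ι (Fin n) ℝ)
    {B : Matrix (Fin n) (Fin n) ℝ} (hB : B.IsHermitian) (hAB : Aᵀ * A = B) :
    schattenPow p A = ∑ i, √(hB.eigenvalues i) ^ p := by
  classical
  have hfr : Module.finrank ℝ (EuclideanSpace ℝ (Fin n)) = n := by simp
  have h1 : schattenPow p A =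
      ∑ i, √((toEuclideanLin A).isSymmetric_adjoint_comp_self.eigenvalues hfr i) ^ p :=
    Finset.sum_congr rfl fun i _ => by rw [LinearMap.singularValues_fin _ hfr i]
  have h2 : LinearMap.adjoint (toEuclideanLin A) ∘ₗ toEuclideanLin A = toEuclideanLin B := by
    rw [← toEuclideanLin_conjTranspose_eq_adjoint, conjTranspose_eq_transpose_of_trivial, ← hAB]
    ext x i
    simp [toLpLin_apply]
  rw [h1, sum_eigenvalues_eq_sum_roots _ hfr (fun x => √x ^ p), h2]
  have h3 : (toEuclideanLin B).charpoly = B.charpoly := by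
    rw [toEuclideanLin_eq_toLin_orthonormal, Matrix.charpoly_toLin]
  rw [h3, hB.roots_charpoly_eq_eigenvalues, Multiset.map_map]
  rfl

theorem fromRows_transpose_mul_self (μ : ℝ) (Z : Matrix (Fin n) (Fin n) ℝ) :
    (fromRows Z (μ • (1 : Matrix (Fin n) (Fin n) ℝ)))ᵀ *
      fromRows Z (μ • (1 : Matrix (Fin n) (Fin n) ℝ)) = regGram μ Z := by
  rw [transpose_fromRows, fromCols_mul_fromRows, regGram]
  simp [sq, smul_smul]

theorem sqrt_rpow {x : ℝ} (hx : 0 ≤ x) (p : ℝ) : √x ^ p = x ^ (p / 2) := by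
  rw [Real.sqrt_eq_rpow, ← Real.rpow_mul hx]
  congr 1
  ring

theorem schattenPow_fromRows (p : ℝ) {μ : ℝ} (hμ : 0 < μ) (Z : Matrix (Fin n) (Fin n) ℝ) :
    schattenPow p (fromRows Z (μ • (1 : Matrix (Fin n) (Fin n) ℝ))) =
      (cfc (fun x : ℝ => x ^ (p / 2)) (regGram μ Z)).trace := by
  rw [schattenPow_eq_sum p _ (regGram_posDef hμ Z).isHermitian (fromRows_transpose_mul_self μ Z),
    trace_cfc (regGram_posDef hμ Z).isHermitian]
  exact Finset.sum_congr rfl fun i _ => sqrt_rpow ((regGram_posDef hμ Z).eigenvalues_pos i).le p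

end Spectral

end SmoothedLRR

namespace SmoothedLRR

/-! ### Majorization, descent and the first-order condition -/

section Descent

variable {m n : ℕ}

open Matrix

theorem colNorm_sq {ι : Type*} [Fintype ι] (A : Matrix ι (Fin n) ℝ) (j : Fin n) :
    colNorm A j ^ 2 = (Aᵀ * A) j j := by
  rw [colNorm, EuclideanSpace.real_norm_sq_eq, mul_apply]
  simp [sq]

theorem colNorm_fromRows (μ : ℝ) (R : Matrix (Fin m) (Fin n) ℝ) (j : Fin n) :
    colNorm (fromRows R (replicateRow Unit fun _ : Fin n => μ)) j = √(colNorm R j ^ 2 + μ ^ 2) := by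
  rw [← Real.sqrt_sq (show 0 ≤ colNorm (fromRows R (replicateRow Unit fun _ : Fin n => μ)) j from
    norm_nonneg _), colNorm_sq, colNorm_sq, mul_apply, mul_apply]
  simp [sq]

theorem objective_eq (X : Matrix (Fin m) (Fin n) ℝ) (p q lam : ℝ) {μ : ℝ} (hμ : 0 < μ)
    (Z : Matrix (Fin n) (Fin n) ℝ) :
    objective X p q lam μ Z = (cfc (fun x : ℝ => x ^ (p / 2)) (regGram μ Z)).trace +
      lam * ∑ j, (colNorm (X * Z - X) j ^ 2 + μ ^ 2) ^ (q / 2) := by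
  rw [objective, schattenPow_fromRows p hμ, l2qPow]
  congr 2
  exact Finset.sum_congr rfl fun j _ => by rw [colNorm_fromRows, sqrt_rpow (by positivity)]

theorem weightM_transpose (p μ : ℝ) (Z : Matrix (Fin n) (Fin n) ℝ) :
    (weightM p μ Z)ᵀ = weightM p μ Z :=
  cfc_transpose _ _

theorem weightN_transpose (X : Matrix (Fin m) (Fin n) ℝ) (q μ : ℝ)
    (Z : Matrix (Fin n) (Fin n) ℝ) : (weightN X q μ Z)ᵀ = weightN X q μ Z :=
  diagonal_transpose _

theorem continuous_weightN (X : Matrix (Fin m) (Fin n) ℝ) (q : ℝ) {μ : ℝ} (hμ : 0 < μ) :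
    Continuous (weightN X q μ) := by
  refine Continuous.matrix_diagonal (continuous_pi fun i => ?_)
  simp only [colNorm_sq]
  refine Continuous.rpow_const ?_ fun Z => Or.inl ?_
  · have h : Continuous fun Z : Matrix (Fin n) (Fin n) ℝ => X * Z - X :=
      (continuous_const.matrix_mul continuous_id).sub continuous_const
    exact ((h.matrix_transpose.matrix_mul h).matrix_elem i i).add continuous_const
  · rw [← colNorm_sq]
    positivity

theorem continuous_irlsLHS (X : Matrix (Fin m) (Fin n) ℝ) (p q lam : ℝ) :
    Continuous fun w : Matrix (Fin n) (Fin n) ℝ × Matrix (Fin n) (Fin n) ℝ ×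
      Matrix (Fin n) (Fin n) ℝ => irlsLHS X p q lam w.1 w.2.1 w.2.2 := by
  unfold irlsLHS
  have h : Continuous fun w : Matrix (Fin n) (Fin n) ℝ × Matrix (Fin n) (Fin n) ℝ ×
      Matrix (Fin n) (Fin n) ℝ => X * w.1 - X :=
    (continuous_const.matrix_mul continuous_fst).sub continuous_const
  exact ((continuous_fst.matrix_mul continuous_snd.fst).const_smul p).add
    (((continuous_const.matrix_mul h).matrix_mul continuous_snd.snd).const_smul (lam * q))

/-- The weighted least squares objective
`p / 2 * tr (M Zᵀ Z) + λ q / 2 * tr (N (X Z - X)ᵀ (X Z - X))`. -/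
noncomputable def surrogate (X : Matrix (Fin m) (Fin n) ℝ) (p q lam : ℝ)
    (M N Z : Matrix (Fin n) (Fin n) ℝ) : ℝ :=
  p / 2 * (M * (Zᵀ * Z)).trace + lam * (q / 2) * (N * ((X * Z - X)ᵀ * (X * Z - X))).trace

theorem objective_le_surrogate (X : Matrix (Fin m) (Fin n) ℝ) {p q lam μ : ℝ}
    (hp0 : 0 < p) (hp2 : p < 2) (hq0 : 0 < q) (hq2 : q < 2) (hlam : 0 < lam) (hμ : 0 < μ)
    (Z Z' : Matrix (Fin n) (Fin n) ℝ) :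
    objective X p q lam μ Z' ≤ objective X p q lam μ Z +
      (surrogate X p q lam (weightM p μ Z) (weightN X q μ Z) Z' -
        surrogate X p q lam (weightM p μ Z) (weightN X q μ Z) Z) := by
  rw [objective_eq X p q lam hμ, objective_eq X p q lam hμ, surrogate, surrogate]
  have h1 := trace_cfc_le (regGram_posDef hμ Z').isHermitian (regGram_posDef hμ Z).isHermitian
    (f := fun x => x ^ (p / 2)) (g := fun x => p / 2 * x ^ (p / 2 - 1)) (s := Set.Ioi 0)
    (fun i => (regGram_posDef hμ Z').eigenvalues_pos i)
    (fun i => (regGram_posDef hμ Z).eigenvalues_pos i)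
    (fun x hx y hy => rpow_le_tangent (by linarith) (by linarith) hx hy)
  have h2 : cfc (fun x : ℝ => p / 2 * x ^ (p / 2 - 1)) (regGram μ Z) =
      (p / 2) • weightM p μ Z :=
    cfc_const_mul (p := IsSelfAdjoint) (p / 2) (fun x : ℝ => x ^ (p / 2 - 1)) (regGram μ Z)
      ((regGram μ Z).finite_real_spectrum.continuousOn _)
  have h3 : regGram μ Z' - regGram μ Z = Z'ᵀ * Z' - Zᵀ * Z := add_sub_add_right_eq_sub _ _ _
  rw [h2, h3, Matrix.smul_mul, trace_smul, Matrix.mul_sub, trace_sub, smul_eq_mul] at h1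
  -- The column term needs only the scalar tangent bound, since `N` is diagonal.
  have h4 : ∑ j, (colNorm (X * Z' - X) j ^ 2 + μ ^ 2) ^ (q / 2) ≤
      ∑ j, (colNorm (X * Z - X) j ^ 2 + μ ^ 2) ^ (q / 2) +
        q / 2 * ((weightN X q μ Z * ((X * Z' - X)ᵀ * (X * Z' - X))).trace -
          (weightN X q μ Z * ((X * Z - X)ᵀ * (X * Z - X))).trace) := by
    simp only [trace, diag_apply, weightN, diagonal_mul, ← colNorm_sq]
    rw [← Finset.sum_sub_distrib, Finset.mul_sum, ← Finset.sum_add_distrib]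
    refine Finset.sum_le_sum fun j _ => ?_
    have h := rpow_le_tangent (s := q / 2) (by linarith) (by linarith)
      (show 0 < colNorm (X * Z' - X) j ^ 2 + μ ^ 2 by positivity)
      (show 0 < colNorm (X * Z - X) j ^ 2 + μ ^ 2 by positivity)
    linarith
  have h5 := mul_le_mul_of_nonneg_left h4 hlam.le
  linarith

theorem trace_mul_gram_sub {ι : Type*} [Fintype ι] {M : Matrix (Fin n) (Fin n) ℝ} (hM : Mᵀ = M)
    (B D : Matrix ι (Fin n) ℝ) :
    (M * ((B + D)ᵀ * (B + D))).trace - (M * (Bᵀ * B)).trace =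
      2 * ((B * M)ᵀ * D).trace + (M * (Dᵀ * D)).trace := by
  have h : (M * (Dᵀ * B)).trace = (M * (Bᵀ * D)).trace := by
    rw [← trace_transpose, transpose_mul, transpose_mul, transpose_transpose, hM, trace_mul_comm]
  rw [transpose_mul, hM, Matrix.mul_assoc, transpose_add]
  simp only [Matrix.add_mul, Matrix.mul_add, trace_add, h]
  ring

/-- Exact second-order expansion at `B`: the surrogate is quadratic, with gradient `irlsLHS` there.
-/
theorem surrogate_sub (X : Matrix (Fin m) (Fin n) ℝ) (p q lam : ℝ)
    {M N : Matrix (Fin n) (Fin n) ℝ} (hM : Mᵀ = M) (hN : Nᵀ = N)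
    (A B : Matrix (Fin n) (Fin n) ℝ) :
    surrogate X p q lam M N A - surrogate X p q lam M N B =
      ((irlsLHS X p q lam B M N)ᵀ * (A - B)).trace +
        (p / 2 * (M * ((A - B)ᵀ * (A - B))).trace +
          lam * (q / 2) * (N * ((X * (A - B))ᵀ * (X * (A - B)))).trace) := by
  have h1 := trace_mul_gram_sub hM B (A - B)
  have h2 := trace_mul_gram_sub hN (X * B - X) (X * (A - B))
  rw [add_sub_cancel] at h1
  rw [show X * B - X + X * (A - B) = X * A - X by rw [Matrix.mul_sub]; abel] at h2
  have h3 : ((irlsLHS X p q lam B M N)ᵀ * (A - B)).trace =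
      p * ((B * M)ᵀ * (A - B)).trace +
        lam * q * (((X * B - X) * N)ᵀ * (X * (A - B))).trace := by
    rw [irlsLHS, Matrix.mul_assoc, transpose_add, transpose_smul, transpose_smul, Matrix.add_mul,
      Matrix.smul_mul, Matrix.smul_mul, trace_add, trace_smul, trace_smul, transpose_mul Xᵀ,
      transpose_transpose, Matrix.mul_assoc _ X]
    rfl
  rw [h3, surrogate, surrogate]
  linear_combination p / 2 * h1 + lam * (q / 2) * h2

theorem trace_transpose_mul_self_eq_sum {ι : Type*} [Fintype ι] (D : Matrix ι (Fin n) ℝ) :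
    (Dᵀ * D).trace = ∑ j, ∑ i, D i j ^ 2 := by
  simp [trace, mul_apply, sq]

theorem trace_weightN_mul_nonneg (X : Matrix (Fin m) (Fin n) ℝ) (q μ : ℝ)
    (Z : Matrix (Fin n) (Fin n) ℝ) (D : Matrix (Fin m) (Fin n) ℝ) :
    0 ≤ (weightN X q μ Z * (Dᵀ * D)).trace := by
  simp only [trace, diag_apply, weightN, diagonal_mul, ← colNorm_sq]
  exact Finset.sum_nonneg fun j _ => by positivity

theorem const_mul_trace_le_trace_weightM_mul {p μ c : ℝ} (hμ : 0 < μ)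
    {Z : Matrix (Fin n) (Fin n) ℝ}
    (hc : ∀ i, c ≤ (regGram_posDef hμ Z).isHermitian.eigenvalues i ^ (p / 2 - 1))
    (D : Matrix (Fin n) (Fin n) ℝ) :
    c * (Dᵀ * D).trace ≤ (weightM p μ Z * (Dᵀ * D)).trace := by
  have h1 : (Dᵀ * D).trace = (cfc (fun _ => (1 : ℝ)) (regGram μ Z) * (Dᵀ * D)).trace := by
    rw [cfc_const_one ℝ _ (regGram_posDef hμ Z).isHermitian.isSelfAdjoint, Matrix.one_mul]
  have h2 : (weightM p μ Z * (Dᵀ * D)).trace =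
    (cfc (fun x : ℝ => x ^ (p / 2 - 1)) (regGram μ Z) * (Dᵀ * D)).trace := rfl
  rw [h1, h2, trace_cfc_mul_transpose_mul_self (regGram_posDef hμ Z).isHermitian,
    trace_cfc_mul_transpose_mul_self (regGram_posDef hμ Z).isHermitian, Finset.mul_sum]
  refine Finset.sum_le_sum fun i _ => ?_
  rw [one_mul]
  exact mul_le_mul_of_nonneg_right (hc i) (Finset.sum_nonneg fun _ _ => sq_nonneg _)

theorem trace_weightM_mul_nonneg {p μ : ℝ} (hμ : 0 < μ) (Z D : Matrix (Fin n) (Fin n) ℝ) :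
    0 ≤ (weightM p μ Z * (Dᵀ * D)).trace := by
  have h := const_mul_trace_le_trace_weightM_mul (p := p) (c := 0) hμ (Z := Z)
    (fun i => Real.rpow_nonneg ((regGram_posDef hμ Z).eigenvalues_pos i).le _) D
  linarith

theorem objective_nonneg (X : Matrix (Fin m) (Fin n) ℝ) (p q : ℝ) {lam μ : ℝ}
    (hlam : 0 < lam) (Z : Matrix (Fin n) (Fin n) ℝ) : 0 ≤ objective X p q lam μ Z := by
  refine add_nonneg (Finset.sum_nonneg fun i _ => Real.rpow_nonneg ?_ _)
    (mul_nonneg hlam.le (Finset.sum_nonneg fun j _ => Real.rpow_nonneg (norm_nonneg _) _))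
  exact LinearMap.singularValues_nonneg _ _

/-- Each eigenvalue satisfies `a ^ (p / 2) ≤ J ≤ K`, so `a ≤ K ^ (2 / p)`; the exponent `p / 2 - 1`
is negative and reverses the inequality. The bound is uniform over a sublevel set of `J`. -/
theorem le_eigenvalues_rpow (X : Matrix (Fin m) (Fin n) ℝ) {p q lam μ K : ℝ}
    (hp0 : 0 < p) (hp2 : p < 2) (hlam : 0 < lam) (hμ : 0 < μ)
    {Z : Matrix (Fin n) (Fin n) ℝ} (hK : objective X p q lam μ Z ≤ K) (i : Fin n) :
    (K ^ (2 / p)) ^ (p / 2 - 1) ≤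
      (regGram_posDef hμ Z).isHermitian.eigenvalues i ^ (p / 2 - 1) := by
  have ha := (regGram_posDef hμ Z).eigenvalues_pos i
  refine Real.rpow_le_rpow_of_nonpos ha ?_ (by linarith)
  rw [objective_eq X p q lam hμ, trace_cfc (regGram_posDef hμ Z).isHermitian] at hK
  have h1 := Finset.single_le_sum
    (f := fun i => (regGram_posDef hμ Z).isHermitian.eigenvalues i ^ (p / 2))
    (fun i _ => Real.rpow_nonneg ((regGram_posDef hμ Z).eigenvalues_pos i).le _)
    (Finset.mem_univ i)
  have h2 : 0 ≤ lam * ∑ j, (colNorm (X * Z - X) j ^ 2 + μ ^ 2) ^ (q / 2) := by positivity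
  have h3 : (regGram_posDef hμ Z).isHermitian.eigenvalues i ^ (p / 2) ≤ K := by
    linarith
  have h4 := Real.rpow_le_rpow (by positivity) h3 (show 0 ≤ 2 / p by positivity)
  rwa [← Real.rpow_mul ha.le, show p / 2 * (2 / p) = 1 by field_simp, Real.rpow_one] at h4

/-- The index starts at `t + 1` because `M 0 = N 0 = 1` are not the weights of any iterate. The
surrogate is expanded at the new iterate, where its gradient vanishes. -/
theorem IsIRLS.objective_add_le {X : Matrix (Fin m) (Fin n) ℝ} {p q lam μ : ℝ}
    (hp0 : 0 < p) (hp2 : p < 2) (hq0 : 0 < q) (hq2 : q < 2) (hlam : 0 < lam) (hμ : 0 < μ)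
    {Z M N : ℕ → Matrix (Fin n) (Fin n) ℝ} (hZ : IsIRLS X p q lam μ Z M N) (t : ℕ) :
    objective X p q lam μ (Z (t + 2)) +
      p / 2 * (M (t + 1) * ((Z (t + 1) - Z (t + 2))ᵀ * (Z (t + 1) - Z (t + 2)))).trace ≤
        objective X p q lam μ (Z (t + 1)) := by
  have h1 := objective_le_surrogate X hp0 hp2 hq0 hq2 hlam hμ (Z (t + 1)) (Z (t + 2))
  have h2 := surrogate_sub X p q lam (weightM_transpose p μ (Z (t + 1)))
    (weightN_transpose X q μ (Z (t + 1))) (Z (t + 1)) (Z (t + 2))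
  have h3 := hZ.stepZ (t + 1)
  rw [hZ.stepM t, hZ.stepN t] at h3
  rw [h3] at h2
  have h4 := trace_weightN_mul_nonneg X q μ (Z (t + 1)) (X * (Z (t + 1) - Z (t + 2)))
  have h5 := mul_nonneg (show 0 ≤ lam * (q / 2) by positivity) h4
  rw [hZ.stepM t]
  simp only [transpose_zero, Matrix.zero_mul, trace_zero] at h2
  linarith

theorem IsIRLS.antitone_objective {X : Matrix (Fin m) (Fin n) ℝ} {p q lam μ : ℝ}
    (hp0 : 0 < p) (hp2 : p < 2) (hq0 : 0 < q) (hq2 : q < 2) (hlam : 0 < lam) (hμ : 0 < μ)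
    {Z M N : ℕ → Matrix (Fin n) (Fin n) ℝ} (hZ : IsIRLS X p q lam μ Z M N) :
    Antitone fun t => objective X p q lam μ (Z (t + 1)) := by
  refine antitone_nat_of_succ_le fun t => ?_
  have h1 := hZ.objective_add_le hp0 hp2 hq0 hq2 hlam hμ t
  have h2 := trace_weightM_mul_nonneg (p := p) hμ (Z (t + 1)) (Z (t + 1) - Z (t + 2))
  rw [← hZ.stepM t] at h2
  have h3 := mul_nonneg (show 0 ≤ p / 2 by positivity) h2
  linarith

theorem IsIRLS.tendsto_sub {X : Matrix (Fin m) (Fin n) ℝ} {p q lam μ : ℝ}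
    (hp0 : 0 < p) (hp2 : p < 2) (hq0 : 0 < q) (hq2 : q < 2) (hlam : 0 < lam) (hμ : 0 < μ)
    {Z M N : ℕ → Matrix (Fin n) (Fin n) ℝ} (hZ : IsIRLS X p q lam μ Z M N) :
    Tendsto (fun t => Z (t + 1) - Z (t + 2)) atTop (𝓝 0) := by
  set J : ℕ → ℝ := fun t => objective X p q lam μ (Z (t + 1)) with hJ
  have hanti : Antitone J := hZ.antitone_objective hp0 hp2 hq0 hq2 hlam hμ
  have hbdd : BddBelow (Set.range J) :=
    ⟨0, by rintro _ ⟨t, rfl⟩; exact objective_nonneg X p q hlam _⟩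
  have hlim := tendsto_atTop_ciInf hanti hbdd
  have hdiff : Tendsto (fun t => J t - J (t + 1)) atTop (𝓝 0) := by
    simpa using hlim.sub (hlim.comp (tendsto_add_atTop_nat 1))
  -- Lower bound for the eigenvalues of every `M (t + 1)`; the `+ 1` makes the base positive even if
  -- `J 0 = 0`.
  set c : ℝ := ((J 0 + 1) ^ (2 / p)) ^ (p / 2 - 1) with hc
  have hJ0 : 0 ≤ J 0 := objective_nonneg X p q hlam _
  have hcpos : 0 < p / 2 * c := by positivity
  have hle : ∀ t, (p / 2 * c) *
      ((Z (t + 1) - Z (t + 2))ᵀ * (Z (t + 1) - Z (t + 2))).trace ≤ J t - J (t + 1) := by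
    intro t
    have h1 := hZ.objective_add_le hp0 hp2 hq0 hq2 hlam hμ t
    have h2 := const_mul_trace_le_trace_weightM_mul (p := p) (c := c) hμ (Z := Z (t + 1))
      (fun i => le_eigenvalues_rpow X (q := q) (lam := lam) hp0 hp2 hlam hμ
        ((hanti (Nat.zero_le t)).trans (by linarith)) i) (Z (t + 1) - Z (t + 2))
    rw [← hZ.stepM t] at h2
    have h3 := mul_le_mul_of_nonneg_left h2 (show 0 ≤ p / 2 by positivity)
    simp only [hJ]
    linarith
  refine tendsto_pi_nhds.2 fun i => tendsto_pi_nhds.2 fun j => ?_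
  have hsq : Tendsto (fun t => (Z (t + 1) - Z (t + 2)) i j ^ 2) atTop (𝓝 0) := by
    refine squeeze_zero (fun t => sq_nonneg _) (g := fun t => (J t - J (t + 1)) / (p / 2 * c))
      (fun t => ?_) (by simpa using hdiff.div_const (p / 2 * c))
    rw [le_div_iff₀' hcpos]
    refine le_trans (mul_le_mul_of_nonneg_left ?_ hcpos.le) (hle t)
    rw [trace_transpose_mul_self_eq_sum]
    refine le_trans ?_ (Finset.single_le_sum
      (f := fun j => ∑ i, (Z (t + 1) - Z (t + 2)) i j ^ 2)
      (fun j _ => Finset.sum_nonneg fun i _ => sq_nonneg _) (Finset.mem_univ j))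
    exact Finset.single_le_sum (f := fun i => (Z (t + 1) - Z (t + 2)) i j ^ 2)
      (fun i _ => sq_nonneg _) (Finset.mem_univ i)
  have habs := (Real.continuous_sqrt.tendsto 0).comp hsq
  rw [Real.sqrt_zero] at habs
  refine (tendsto_zero_iff_abs_tendsto_zero _).2 (habs.congr fun t => ?_)
  exact Real.sqrt_sq_eq_abs _

theorem IsIRLS.firstOrder {X : Matrix (Fin m) (Fin n) ℝ} {p q lam μ : ℝ}
    (hp0 : 0 < p) (hp2 : p < 2) (hq0 : 0 < q) (hq2 : q < 2) (hlam : 0 < lam) (hμ : 0 < μ)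
    {Z M N : ℕ → Matrix (Fin n) (Fin n) ℝ} (hZ : IsIRLS X p q lam μ Z M N)
    {Zs : Matrix (Fin n) (Fin n) ℝ} (hZs : IsLimitPoint Z Zs) :
    irlsLHS X p q lam Zs (weightM p μ Zs) (weightN X q μ Zs) = 0 := by
  obtain ⟨φ, hφ, hlim⟩ := hZs
  -- Shifting to `φ (k + 1) ≥ 1` avoids the unused `Z 0` and makes the truncated subtraction
  -- harmless.
  have hpos : ∀ k, φ (k + 1) - 1 + 1 = φ (k + 1) := fun k =>
    Nat.sub_add_cancel (le_trans (Nat.le_add_left 1 k) (hφ.id_le (k + 1)))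
  have hψ : Tendsto (fun k => φ (k + 1) - 1) atTop atTop :=
    (tendsto_sub_atTop_nat 1).comp (hφ.tendsto_atTop.comp (tendsto_add_atTop_nat 1))
  have h1 : Tendsto (fun k => Z (φ (k + 1) - 1 + 1)) atTop (𝓝 Zs) := by
    simp only [hpos]
    exact hlim.comp (tendsto_add_atTop_nat 1)
  have h2 : Tendsto (fun k => Z (φ (k + 1) - 1 + 2)) atTop (𝓝 Zs) := by
    have h := h1.sub ((hZ.tendsto_sub hp0 hp2 hq0 hq2 hlam hμ).comp hψ)
    simpa using h
  have h3 : Tendsto (fun k => M (φ (k + 1) - 1 + 1)) atTop (𝓝 (weightM p μ Zs)) := by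
    simp only [hZ.stepM]
    exact ((continuous_weightM p hμ).tendsto Zs).comp h1
  have h4 : Tendsto (fun k => N (φ (k + 1) - 1 + 1)) atTop (𝓝 (weightN X q μ Zs)) := by
    simp only [hZ.stepN]
    exact ((continuous_weightN X q hμ).tendsto Zs).comp h1
  have h5 := ((continuous_irlsLHS X p q lam).tendsto
    (Zs, weightM p μ Zs, weightN X q μ Zs)).comp (h2.prodMk_nhds (h3.prodMk_nhds h4))
  refine tendsto_nhds_unique h5 ?_
  simp only [Function.comp_def, hZ.stepZ (_ + 1)]
  exact tendsto_const_nhds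

/-! ### Stationarity from two-sided bounds -/

theorem abs_trace_transpose_mul_le (G D : Matrix (Fin n) (Fin n) ℝ) {r : ℝ}
    (hD : ∀ i j, |D i j| ≤ r) : |(Gᵀ * D).trace| ≤ (∑ j, ∑ i, |G i j|) * r := by
  simp only [trace, diag_apply, mul_apply, transpose_apply]
  rw [Finset.sum_mul]
  refine (Finset.abs_sum_le_sum_abs _ _).trans (Finset.sum_le_sum fun j _ => ?_)
  rw [Finset.sum_mul]
  refine (Finset.abs_sum_le_sum_abs _ _).trans (Finset.sum_le_sum fun i _ => ?_)
  rw [abs_mul]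
  exact mul_le_mul_of_nonneg_left (hD i j) (abs_nonneg _)

attribute [local instance] Matrix.normedAddCommGroup Matrix.normedSpace in
theorem isStationaryPoint_of_bounds {f : Matrix (Fin n) (Fin n) ℝ → ℝ}
    {a : Matrix (Fin n) (Fin n) ℝ} {G H : Matrix (Fin n) (Fin n) ℝ → Matrix (Fin n) (Fin n) ℝ}
    (hG : Continuous G) (hGa : G a = 0) (hH : Continuous H) (hHa : H a = 0)
    (hlower : ∀ Z, ((G Z)ᵀ * (Z - a)).trace ≤ f Z - f a)
    (hupper : ∀ Z, f Z - f a ≤ ((H Z)ᵀ * (Z - a)).trace) : IsStationaryPoint f a := by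
  have key : ∀ {G : Matrix (Fin n) (Fin n) ℝ → Matrix (Fin n) (Fin n) ℝ}, Continuous G →
      G a = 0 → ∀ c > 0, ∀ᶠ Z in 𝓝 a, |((G Z)ᵀ * (Z - a)).trace| ≤ c * ‖Z - a‖ := by
    intro G hG hGa c hc
    have hcont : Continuous fun Z => ∑ j, ∑ i, |G Z i j| :=
      continuous_finsetSum _ fun j _ => continuous_finsetSum _ fun i _ =>
        (hG.matrix_elem i j).abs
    have hlt : ∀ᶠ Z in 𝓝 a, ∑ j, ∑ i, |G Z i j| < c :=
      hcont.continuousAt.eventually_lt continuousAt_const (by simpa [hGa] using hc)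
    filter_upwards [hlt] with Z hZ
    refine (abs_trace_transpose_mul_le (G Z) (Z - a) (r := ‖Z - a‖)
      fun i j => Matrix.norm_entry_le_entrywise_sup_norm (Z - a)).trans ?_
    exact mul_le_mul_of_nonneg_right hZ.le (norm_nonneg _)
  refine HasFDerivAt.of_isLittleO (Asymptotics.isLittleO_iff.2 fun c hc => ?_)
  filter_upwards [key hG hGa c hc, key hH hHa c hc] with Z h1 h2
  change ‖f Z - f a - 0‖ ≤ c * ‖Z - a‖
  rw [sub_zero, Real.norm_eq_abs, abs_le]
  exact ⟨by linarith [hlower Z, (abs_le.1 h1).1], by linarith [hupper Z, (abs_le.1 h2).2]⟩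

/-- `G` is the gradient at `Zs` of the surrogate with weights moving with `Z`; it vanishes at `Zs`
by the first-order condition. `H` pairs with `Z - Zs` to give the quadratic remainder of the
surrogate frozen at `Zs`. -/
theorem isStationaryPoint_objective {X : Matrix (Fin m) (Fin n) ℝ} {p q lam μ : ℝ}
    (hp0 : 0 < p) (hp2 : p < 2) (hq0 : 0 < q) (hq2 : q < 2) (hlam : 0 < lam) (hμ : 0 < μ)
    {Zs : Matrix (Fin n) (Fin n) ℝ}
    (h : irlsLHS X p q lam Zs (weightM p μ Zs) (weightN X q μ Zs) = 0) :
    IsStationaryPoint (objective X p q lam μ) Zs := by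
  refine isStationaryPoint_of_bounds
    (G := fun Z => irlsLHS X p q lam Zs (weightM p μ Z) (weightN X q μ Z))
    (H := fun Z => (p / 2) • ((Z - Zs) * weightM p μ Zs) +
      (lam * (q / 2)) • (Xᵀ * (X * (Z - Zs)) * weightN X q μ Zs)) ?_ h ?_ (by simp) ?_ ?_
  · exact (continuous_irlsLHS X p q lam).comp (continuous_const.prodMk
      ((continuous_weightM p hμ).prodMk (continuous_weightN X q hμ)))
  · have hc : Continuous fun Z : Matrix (Fin n) (Fin n) ℝ => Z - Zs :=
      continuous_id.sub continuous_const
    have hc' : Continuous fun Z : Matrix (Fin n) (Fin n) ℝ => Xᵀ * (X * (Z - Zs)) :=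
      continuous_const.matrix_mul (continuous_const.matrix_mul hc)
    exact ((hc.matrix_mul continuous_const).const_smul (p / 2)).add
      ((hc'.matrix_mul continuous_const).const_smul (lam * (q / 2)))
  · intro Z
    have h1 := objective_le_surrogate X hp0 hp2 hq0 hq2 hlam hμ Z Zs
    have h2 := surrogate_sub X p q lam (weightM_transpose p μ Z) (weightN_transpose X q μ Z) Z Zs
    have h3 := mul_nonneg (show 0 ≤ lam * (q / 2) by positivity)
      (trace_weightN_mul_nonneg X q μ Z (X * (Z - Zs)))
    have h4 := mul_nonneg (show 0 ≤ p / 2 by positivity)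
      (trace_weightM_mul_nonneg (p := p) hμ Z (Z - Zs))
    linarith
  · intro Z
    have h1 := objective_le_surrogate X hp0 hp2 hq0 hq2 hlam hμ Zs Z
    have h2 := surrogate_sub X p q lam (weightM_transpose p μ Zs) (weightN_transpose X q μ Zs) Z Zs
    rw [h, transpose_zero, Matrix.zero_mul, trace_zero, zero_add] at h2
    have h3 : (((p / 2) • ((Z - Zs) * weightM p μ Zs) +
        (lam * (q / 2)) • (Xᵀ * (X * (Z - Zs)) * weightN X q μ Zs))ᵀ * (Z - Zs)).trace =
        p / 2 * (weightM p μ Zs * ((Z - Zs)ᵀ * (Z - Zs))).trace +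
          lam * (q / 2) * (weightN X q μ Zs * ((X * (Z - Zs))ᵀ * (X * (Z - Zs)))).trace := by
      rw [transpose_add, transpose_smul, transpose_smul, transpose_mul,
        transpose_mul _ (weightN _ _ _ _), transpose_mul Xᵀ, transpose_transpose, weightM_transpose,
        weightN_transpose]
      simp only [Matrix.add_mul, Matrix.smul_mul, trace_add, trace_smul, smul_eq_mul,
        Matrix.mul_assoc]
    rw [h3]
    linarith

end Descent

end SmoothedLRR

namespace SmoothedLRR

/-! ### Convexity of the objective and global minimality -/

section Convexity

variable {m n : ℕ}

open Matrix

/-- Injectivity makes every singular value positive, so `A (y i)` can be normalized to give `x i`.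
-/
theorem exists_singular_vectors {ι : Type*} [Fintype ι] {A : Matrix ι (Fin n) ℝ}
    (hA : Function.Injective (toEuclideanLin A)) :
    ∃ (x : Fin n → EuclideanSpace ℝ ι) (y : OrthonormalBasis (Fin n) ℝ (EuclideanSpace ℝ (Fin n))),
      Orthonormal ℝ x ∧
        ∀ i, toEuclideanLin A (y i) = (toEuclideanLin A).singularValues i • x i := by
  have hfr : Module.finrank ℝ (EuclideanSpace ℝ (Fin n)) = n := by simp
  set T := toEuclideanLin A with hT
  set y := T.isSymmetric_adjoint_comp_self.eigenvectorBasis hfr with hy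
  have hσ : ∀ i : Fin n, 0 < T.singularValues i := fun i =>
    T.injective_iff_forall_lt_finrank_singularValues_pos.1 hA i (by rw [hfr]; exact i.2)
  have hinner : ∀ i j, inner ℝ (T (y i)) (T (y j)) =
      if i = j then T.singularValues i ^ 2 else 0 := by
    intro i j
    have h := T.isSymmetric_adjoint_comp_self.apply_eigenvectorBasis hfr j
    rw [← LinearMap.adjoint_inner_right, ← LinearMap.comp_apply, h, ← T.sq_singularValues_fin hfr,
      inner_smul_right, orthonormal_iff_ite.1 y.orthonormal i j]
    split_ifs with hij
    · simp [hij]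
    · simp
  refine ⟨fun i => (T.singularValues i)⁻¹ • T (y i), y, ?_, fun i => ?_⟩
  · refine orthonormal_iff_ite.2 fun i j => ?_
    rw [real_inner_smul_left, real_inner_smul_right, hinner]
    split_ifs with hij
    · subst hij
      have := (hσ i).ne'
      field_simp
    · simp
  · rw [smul_smul, mul_inv_cancel₀ (hσ i).ne', one_smul]

theorem rpow_sum_mul_le {ι : Type*} [Fintype ι] {p : ℝ} (hp : 1 ≤ p) {w σ : ι → ℝ}
    (hw : ∀ k, 0 ≤ w k) (hw1 : ∑ k, w k ≤ 1) (hσ : ∀ k, 0 ≤ σ k) :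
    (∑ k, w k * σ k) ^ p ≤ ∑ k, w k * σ k ^ p := by
  -- Jensen with the missing mass placed at `0`, where the power vanishes.
  have h := (convexOn_rpow hp).map_add_sum_le (t := Finset.univ) (w := w) (p := σ)
    (v := 1 - ∑ k, w k) (q := 0) (fun k _ => hw k) (by ring) (fun k _ => hσ k) (by linarith)
    (by simp)
  simpa [Real.zero_rpow (by linarith : p ≠ 0)] using h

theorem sum_sq_inner_le_one {E : Type*} [NormedAddCommGroup E] [InnerProductSpace ℝ E]
    {e : Fin n → E} (he : Orthonormal ℝ e) {z : E} (hz : ‖z‖ = 1) :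
    ∑ k, inner ℝ (e k) z ^ 2 ≤ 1 := by
  have h := he.sum_inner_products_le (s := Finset.univ) z
  simpa [hz] using h

/-- Expanding in singular vectors and using `|a b| ≤ (a² + b²) / 2` bounds each `|⟨u i, A v i⟩|` by
a combination of singular values with weights `w`. By Bessel, `w` has row sums at most `1`, which
allows Jensen, and column sums at most `1`, which gives the final bound. -/
theorem sum_rpow_abs_inner_le_schattenPow {ι : Type*} [Fintype ι] {p : ℝ} (hp : 1 ≤ p)
    {A : Matrix ι (Fin n) ℝ} (hA : Function.Injective (toEuclideanLin A))
    {u : Fin n → EuclideanSpace ℝ ι} {v : Fin n → EuclideanSpace ℝ (Fin n)}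
    (hu : Orthonormal ℝ u) (hv : Orthonormal ℝ v) :
    ∑ i, |inner ℝ (u i) (toEuclideanLin A (v i))| ^ p ≤ schattenPow p A := by
  obtain ⟨x, y, hx, hxy⟩ := exists_singular_vectors hA
  set T := toEuclideanLin A with hT
  set w : Fin n → Fin n → ℝ := fun i k => (inner ℝ (u i) (x k) ^ 2 + inner ℝ (v i) (y k) ^ 2) / 2
  have hrow : ∀ i, ∑ k, w i k ≤ 1 := by
    intro i
    simp only [w]
    rw [← Finset.sum_div, Finset.sum_add_distrib]
    have h1 := sum_sq_inner_le_one hx (hu.1 i)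
    have h2 := sum_sq_inner_le_one y.orthonormal (hv.1 i)
    simp only [real_inner_comm (u i), real_inner_comm (v i)] at h1 h2 ⊢
    linarith
  have hcol : ∀ k, ∑ i, w i k ≤ 1 := by
    intro k
    simp only [w]
    rw [← Finset.sum_div, Finset.sum_add_distrib]
    linarith [sum_sq_inner_le_one hu (hx.1 k), sum_sq_inner_le_one hv (y.orthonormal.1 k)]
  have hw : ∀ i k, 0 ≤ w i k := fun i k => by positivity
  have hσ : ∀ k : Fin n, 0 ≤ T.singularValues k := fun k => T.singularValues_nonneg k
  have hin : ∀ i, |inner ℝ (u i) (T (v i))| ≤ ∑ k, w i k * T.singularValues k := by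
    intro i
    have h1 : T (v i) = ∑ k : Fin n, (inner ℝ (y k) (v i) * T.singularValues k) • x k := by
      conv_lhs => rw [← y.sum_repr' (v i), map_sum]
      exact Finset.sum_congr rfl fun k _ => by rw [map_smul, hxy, smul_smul]
    rw [h1, inner_sum]
    refine (Finset.abs_sum_le_sum_abs _ _).trans (Finset.sum_le_sum fun k _ => ?_)
    rw [inner_smul_right, real_inner_comm, mul_right_comm, abs_mul, abs_of_nonneg (hσ k)]
    refine mul_le_mul_of_nonneg_right ?_ (hσ k)
    simp only [w]
    rw [abs_le]
    constructor <;>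
      nlinarith [sq_nonneg (inner ℝ (u i) (x k) + inner ℝ (v i) (y k)),
        sq_nonneg (inner ℝ (u i) (x k) - inner ℝ (v i) (y k))]
  calc ∑ i, |inner ℝ (u i) (T (v i))| ^ p
      ≤ ∑ i, ∑ k, w i k * T.singularValues k ^ p :=
        Finset.sum_le_sum fun i _ => (Real.rpow_le_rpow (abs_nonneg _) (hin i) (by linarith)).trans
          (rpow_sum_mul_le hp (hw i) (hrow i) hσ)
    _ = ∑ k, (∑ i, w i k) * T.singularValues k ^ p := by
        rw [Finset.sum_comm]
        simp only [Finset.sum_mul]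
    _ ≤ ∑ k : Fin n, T.singularValues k ^ p := Finset.sum_le_sum fun k _ =>
        mul_le_of_le_one_left (Real.rpow_nonneg (hσ k) p) (hcol k)

theorem toEuclideanLin_fromRows_injective {μ : ℝ} (hμ : 0 < μ) (Z : Matrix (Fin n) (Fin n) ℝ) :
    Function.Injective (toEuclideanLin (fromRows Z (μ • (1 : Matrix (Fin n) (Fin n) ℝ)))) := by
  refine (injective_iff_map_eq_zero _).2 fun v hv => ?_
  ext i
  have h := congrArg (fun w => w (Sum.inr i)) hv
  simpa [toLpLin_apply, fromRows_mulVec, smul_mulVec, hμ.ne'] using h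

theorem abs_convexComb_rpow_le {p : ℝ} (hp : 1 ≤ p) {a b r s : ℝ} (ha : 0 ≤ a) (hb : 0 ≤ b)
    (hab : a + b = 1) : |a * r + b * s| ^ p ≤ a * |r| ^ p + b * |s| ^ p := by
  have h1 : |a * r + b * s| ≤ a * |r| + b * |s| := by
    refine (abs_add_le _ _).trans_eq ?_
    rw [abs_mul, abs_mul, abs_of_nonneg ha, abs_of_nonneg hb]
  exact (Real.rpow_le_rpow (abs_nonneg _) h1 (by linarith)).trans
    ((convexOn_rpow hp).2 (abs_nonneg r) (abs_nonneg s) ha hb hab)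

theorem fromRows_convexComb {ι κ : Type*} (C : Matrix κ (Fin n) ℝ) {a b : ℝ} (hab : a + b = 1)
    (Y Z : Matrix ι (Fin n) ℝ) :
    fromRows (a • Y + b • Z) C = a • fromRows Y C + b • fromRows Z C := by
  ext (i | i) j
  · simp
  · simp [← add_mul, hab]

theorem convexOn_schattenPow_fromRows {p μ : ℝ} (hp : 1 ≤ p) (hμ : 0 < μ) :
    ConvexOn ℝ Set.univ fun Z : Matrix (Fin n) (Fin n) ℝ =>
      schattenPow p (fromRows Z (μ • (1 : Matrix (Fin n) (Fin n) ℝ))) := by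
  refine ⟨convex_univ, fun Y _ Z _ a b ha hb hab => ?_⟩
  -- The singular vectors of the convex combination attain equality there and serve as test families
  -- for both `Y` and `Z`.
  obtain ⟨x, y, hx, hxy⟩ :=
    exists_singular_vectors (toEuclideanLin_fromRows_injective hμ (a • Y + b • Z))
  have h1 := sum_rpow_abs_inner_le_schattenPow hp (toEuclideanLin_fromRows_injective hμ Y) hx
    y.orthonormal
  have h2 := sum_rpow_abs_inner_le_schattenPow hp (toEuclideanLin_fromRows_injective hμ Z) hx
    y.orthonormal
  simp only [smul_eq_mul]
  refine le_trans ?_ (add_le_add (mul_le_mul_of_nonneg_left h1 ha)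
    (mul_le_mul_of_nonneg_left h2 hb))
  rw [Finset.mul_sum, Finset.mul_sum, ← Finset.sum_add_distrib]
  refine Finset.sum_le_sum fun i _ => ?_
  refine le_trans (le_of_eq ?_) (abs_convexComb_rpow_le hp ha hb hab)
  have h3 : inner ℝ (x i) (toEuclideanLin (fromRows (a • Y + b • Z)
      (μ • (1 : Matrix (Fin n) (Fin n) ℝ))) (y i)) =
      (toEuclideanLin (fromRows (a • Y + b • Z)
        (μ • (1 : Matrix (Fin n) (Fin n) ℝ)))).singularValues i := by
    rw [hxy, inner_smul_right, real_inner_self_eq_norm_sq, hx.1 i]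
    simp
  rw [← inner_smul_right, ← inner_smul_right, ← inner_add_right, ← LinearMap.smul_apply,
    ← LinearMap.smul_apply, ← LinearMap.add_apply, ← map_smul, ← map_smul, ← map_add,
    ← fromRows_convexComb _ hab, h3, abs_of_nonneg (LinearMap.singularValues_nonneg _ _)]

theorem colNorm_convexComb_le {ι : Type*} [Fintype ι] {a b : ℝ} (ha : 0 ≤ a) (hb : 0 ≤ b)
    (A B : Matrix ι (Fin n) ℝ) (j : Fin n) :
    colNorm (a • A + b • B) j ≤ a * colNorm A j + b * colNorm B j := by
  have h : WithLp.toLp 2 ((a • A + b • B).col j) =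
      a • WithLp.toLp 2 (A.col j) + b • WithLp.toLp 2 (B.col j) := rfl
  rw [colNorm, h]
  refine (norm_add_le _ _).trans_eq ?_
  rw [norm_smul, norm_smul, Real.norm_of_nonneg ha, Real.norm_of_nonneg hb]
  rfl

theorem convexOn_l2qPow {ι : Type*} [Fintype ι] {q : ℝ} (hq : 1 ≤ q) :
    ConvexOn ℝ Set.univ (l2qPow q : Matrix ι (Fin n) ℝ → ℝ) := by
  refine ⟨convex_univ, fun A _ B _ a b ha hb hab => ?_⟩
  simp only [l2qPow, smul_eq_mul]
  rw [Finset.mul_sum, Finset.mul_sum, ← Finset.sum_add_distrib]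
  refine Finset.sum_le_sum fun j _ => ?_
  exact (Real.rpow_le_rpow (norm_nonneg _) (colNorm_convexComb_le ha hb A B j) (by linarith)).trans
    ((convexOn_rpow hq).2 (norm_nonneg _) (norm_nonneg _) ha hb hab)

theorem convexOn_objective (X : Matrix (Fin m) (Fin n) ℝ) {p q lam μ : ℝ} (hp : 1 ≤ p)
    (hq : 1 ≤ q) (hlam : 0 < lam) (hμ : 0 < μ) :
    ConvexOn ℝ Set.univ (objective X p q lam μ) := by
  refine (convexOn_schattenPow_fromRows hp hμ).add (ConvexOn.smul hlam.le ?_)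
  refine ⟨convex_univ, fun Y _ Z _ a b ha hb hab => ?_⟩
  have h : X * (a • Y + b • Z) - X = a • (X * Y - X) + b • (X * Z - X) := by
    have hX : X = a • X + b • X := by rw [← add_smul, hab, one_smul]
    rw [Matrix.mul_add, Matrix.mul_smul, Matrix.mul_smul, smul_sub, smul_sub]
    nth_rewrite 3 [hX]
    abel
  simp only [h]
  rw [fromRows_convexComb _ hab]
  exact (convexOn_l2qPow hq).2 trivial trivial ha hb hab

attribute [local instance] Matrix.normedAddCommGroup Matrix.normedSpace in
theorem IsStationaryPoint.isMinOn {f : Matrix (Fin n) (Fin n) ℝ → ℝ}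
    {a : Matrix (Fin n) (Fin n) ℝ} (h : IsStationaryPoint f a) (hf : ConvexOn ℝ Set.univ f) :
    IsMinOn f Set.univ a := by
  intro b _
  have hline : HasDerivAt (fun t : ℝ => a + t • (b - a)) (b - a) 0 := by
    have h1 := ((hasDerivAt_id (0 : ℝ)).smul_const (b - a)).const_add a
    rwa [one_smul] at h1
  have hfa : HasFDerivAt f (0 : Matrix (Fin n) (Fin n) ℝ →L[ℝ] ℝ) (a + (0 : ℝ) • (b - a)) := by
    rw [zero_smul, add_zero]
    exact h
  have hd : HasDerivAt (f ∘ fun t : ℝ => a + t • (b - a)) 0 0 := hfa.comp_hasDerivAt 0 hline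
  have hs := hd.tendsto_slope_zero_right
  -- By convexity the right slopes on `(0, 1]` are at most `f b - f a`, and they tend to `0`.
  refine sub_nonneg.1 (le_of_tendsto hs ?_)
  filter_upwards [Ioc_mem_nhdsGT (zero_lt_one' ℝ)] with t ht
  have hc := hf.2 (Set.mem_univ a) (Set.mem_univ b) (sub_nonneg.2 ht.2) ht.1.le (by ring)
  have hpt : a + t • (b - a) = (1 - t) • a + t • b := by
    rw [smul_sub, sub_smul, one_smul]
    abel
  simp only [Function.comp_apply, zero_add, zero_smul, add_zero, hpt, smul_eq_mul] at hc ⊢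
  rw [inv_mul_le_iff₀ ht.1]
  linarith

end Convexity

end SmoothedLRR

theorem theorem3 {m n : ℕ} (X : Matrix (Fin m) (Fin n) ℝ) (p q lam μ : ℝ)
    (hp0 : 0 < p) (hp2 : p < 2) (hq0 : 0 < q) (hq2 : q < 2) (hlam : 0 < lam) (hμ : 0 < μ)
    (Z M N : ℕ → Matrix (Fin n) (Fin n) ℝ) (hZ : SmoothedLRR.IsIRLS X p q lam μ Z M N)
    (Zs : Matrix (Fin n) (Fin n) ℝ) (hZs : SmoothedLRR.IsLimitPoint Z Zs) :
    p • (Zs * SmoothedLRR.weightM p μ Zs) +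
        (lam * q) • (X.transpose * (X * Zs - X) * SmoothedLRR.weightN X q μ Zs) = 0 ∧
      SmoothedLRR.IsStationaryPoint (SmoothedLRR.objective X p q lam μ) Zs ∧
      (1 ≤ p → 1 ≤ q →
        ConvexOn ℝ Set.univ (SmoothedLRR.objective X p q lam μ) ∧
          IsMinOn (SmoothedLRR.objective X p q lam μ) Set.univ Zs) := by
  have hfirst := hZ.firstOrder hp0 hp2 hq0 hq2 hlam hμ hZs
  have hstat := SmoothedLRR.isStationaryPoint_objective hp0 hp2 hq0 hq2 hlam hμ hfirst
  refine ⟨hfirst, hstat, fun hp hq => ?_⟩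
  have hconv := SmoothedLRR.convexOn_objective X hp hq hlam hμ
  exact ⟨hconv, hstat.isMinOn hconv⟩
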